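/- Let $\mathcal P_2(\mathbb R)$ be the set of Borel probability measures on $\mathbb R$ with finite second moment, with the Wasserstein metric $W_2$. A coupling of $\mu,\nu\in\mathcal P_2(\mathbb R)$ is a probability measure on $\mathbb R^2$ with marginals $\mu,\nu$; it is optimal if it minimizes $\int (x-x')^2\,d\pi$ among all couplings. A function $\mathfrak f:\mathcal P_2(\mathbb R)\to\mathbb R\cup\{\infty\}$ is proper if it is not identically $\infty$, and convex if for all $\mu,\nu$, every coupling $\pi$ of $\mu,\nu$ and all $\alpha\in[0,1]$, $\mathfrak f(\mathrm{law}(\alpha X+(1-\alpha)X'))\le\alpha\,\mathfrak f(\mu)+(1-\alpha)\,\mathfrak f(\nu)$, where $(X,X')\sim\pi$. Put $$\mathsf{prox}[\mathfrak f](\mu)=\arg\min_{\nu\in\mathcal P_2(\mathbb R)}\Big\{\tfrac12 W_2(\mu,\nu)^2+\mathfrak f(\nu)\Big\}.$$ Let $L_2(0,1)$ be the Hilbert space of (a.e. classes of) square-integrable random variables on $(0,1)$ with Lebesgue measure, write $\mu_Y$ for the law of $Y$, and for $f:L_2(0,1)\to\mathbb R\cup\{\infty\}$ put $\mathsf{prox}[f](Y)=\arg\min_X\{\frac12\mathbb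 E[(Y-X)^2]+f(X)\}$. Call $f$ symmetric if $f(X)$ depends on $X$ only through $\mu_X$. Let $\mathcal{PR}_1$ be the set of maps $\mathbb R\to\mathbb R$, $y\mapsto\arg\min_x\{\frac12(y-x)^2+\rho(x)\}$, with $\rho:\mathbb R\to\mathbb R\cup\{\infty\}$ lower semi-continuous (lsc), proper and convex. A map $\mathfrak A:\mathcal P_2(\mathbb R)\to\mathcal{PR}_1$ is an effective scalar representation of an lsc, proper, convex $\mathfrak f$ on $\mathcal P_2(\mathbb R)$ if for every $\mu$ and $Y\sim\mu$ the law of $(Y,\mathfrak A(\mu)\circ Y)$ is the optimal coupling of $\mu$ and $\mathsf{prox}[\mathfrak f](\mu)$. It is an effective scalar representation of a symmetric, lsc, proper, convex $f$ on $L_2(0,1)$ if it is one of the lsc, proper, convex $\mathfrak f$ on $\mathcal P_2(\mathbb R)$ with $f(X)=\mathfrak f(\mu_X)$ for all $X$. **Theorem.** 1. Let $\mathfrak f:\mathcal P_2(\mathbb R)\to\mathbb R\cup\{\infty\}$ be lsc, proper and convex. For every $\mu\in\mathcal P_2(\mathbb R)$ the minimizer $\mathsf{prox}[\mathfrak f](\mu)$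 exists and is unique, and there is $\eta\in\mathcal{PR}_1$, non-decreasing and $1$-Lipschitz, such that for every random variable $Y\sim\mu$ the law of $(Y,\eta\circ Y)$ is the unique optimal coupling of $\mu$ and $\mathsf{prox}[\mathfrak f](\mu)$. In particular $\mathfrak f$ has an effective scalar representation. 2. Let $f:L_2(0,1)\to\mathbb R\cup\{\infty\}$ be lsc, proper and convex. (a) $\mathsf{prox}[f](Y)$ exists and is unique for every $Y$, and $\mathsf{prox}[f]$ is $1$-Lipschitz. (b) Suppose that $f$ is also symmetric. Then $f$ has an effective scalar representation, and a map $\mathfrak A:\mathcal P_2(\mathbb R)\to\mathcal{PR}_1$ is an effective scalar representation of $f$ if and only if $\mathsf{prox}[f](Y)=\mathfrak A(\mu_Y)\circ Y$ a.e. for all $Y\in L_2(0,1)$. In particular, the joint law of $(Y,\mathsf{prox}[f](Y))$ depends only on $\mu_Y$, and $\mathsf{prox}[f](Y)$ is (a.e. equal to) a $\sigma(Y)$-measurable function. -/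

import Mathlib

open MeasureTheory ProbabilityTheory

noncomputable section

/-! Convex functions and proximal operators on a Hilbert space -/

/-- Lower semi-continuous, proper, convex functions with values in `ℝ ∪ {∞}`. -/
structure LscProperConvex {E : Type*} [NormedAddCommGroup E] [InnerProductSpace ℝ E]
    (f : E → EReal) : Prop where
  lsc : LowerSemicontinuous f
  ne_bot : ∀ x, f x ≠ ⊥
  proper : ∃ x, f x ≠ ⊤
  convex : ∀ x y : E, ∀ α : ℝ, 0 ≤ α → α ≤ 1 →
    f (α • x + (1 - α) • y) ≤ (α : EReal) * f x + ((1 - α : ℝ) : EReal) * f y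

/-- The objective `½ ‖y - x‖² + f x` of the proximal problem. -/
def proxObj {E : Type*} [NormedAddCommGroup E] [InnerProductSpace ℝ E]
    (f : E → EReal) (y x : E) : EReal :=
  ((1 / 2 * ‖y - x‖ ^ 2 : ℝ) : EReal) + f x

/-- `x` minimizes the proximal objective of `f` at `y`. -/
def IsProx {E : Type*} [NormedAddCommGroup E] [InnerProductSpace ℝ E]
    (f : E → EReal) (y x : E) : Prop :=
  ∀ x' : E, proxObj f y x ≤ proxObj f y x'

/-- The proximal operator: a minimizer of the proximal objective (if there is one). -/
def prox {E : Type*} [NormedAddCommGroup E] [InnerProductSpace ℝ E]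
    (f : E → EReal) (y : E) : E :=
  Classical.epsilon (IsProx f y)

/-- The scalar proximal operators of lsc, proper, convex functions `ρ : ℝ → ℝ ∪ {∞}`. -/
def PR1 : Set (ℝ → ℝ) :=
  {η | ∃ ρ : ℝ → EReal, LscProperConvex ρ ∧ ∀ y x : ℝ, IsProx ρ y x ↔ x = η y}

/-! The Wasserstein space of order 2 on the line -/

/-- Borel probability measures on `ℝ` with finite second moment. -/
@[ext]
structure P2 where
  toMeasure : Measure ℝ
  isProb : IsProbabilityMeasure toMeasure
  memLp : MemLp (fun x : ℝ => x) 2 toMeasure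

namespace P2

instance (μ : P2) : IsProbabilityMeasure μ.toMeasure := μ.isProb

instance : Nonempty P2 :=
  ⟨⟨Measure.dirac 0, inferInstance, (memLp_const (0 : ℝ)).ae_eq (by
    rw [Filter.EventuallyEq, ae_dirac_eq]; simp)⟩⟩

/-- `π` is a coupling of `μ` and `ν`: its marginals are `μ` and `ν`. -/
structure IsCoupling (π : Measure (ℝ × ℝ)) (μ ν : P2) : Prop where
  fst_eq : π.map Prod.fst = μ.toMeasure
  snd_eq : π.map Prod.snd = ν.toMeasure

/-- The quadratic transport cost `E[(X - X')²]`, `(X, X') ∼ π`. -/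
def cost (π : Measure (ℝ × ℝ)) : ℝ := ∫ p, (p.1 - p.2) ^ 2 ∂π

/-- The Wasserstein distance of order 2. -/
def W2 (μ ν : P2) : ℝ := Real.sqrt (⨅ π : {π : Measure (ℝ × ℝ) // IsCoupling π μ ν}, cost π.1)

/-- `π` is an optimal coupling of `μ` and `ν`. -/
def IsOptimalCoupling (π : Measure (ℝ × ℝ)) (μ ν : P2) : Prop :=
  IsCoupling π μ ν ∧ ∀ π', IsCoupling π' μ ν → cost π ≤ cost π'

theorem IsCoupling.isProbabilityMeasure {π : Measure (ℝ × ℝ)} {μ ν : P2}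
    (h : IsCoupling π μ ν) : IsProbabilityMeasure π := by
  have h1 : IsProbabilityMeasure (π.map Prod.fst) := by rw [h.fst_eq]; infer_instance
  exact (Measure.isProbabilityMeasure_map_iff measurable_fst.aemeasurable).1 h1

theorem IsCoupling.memLp_mix {π : Measure (ℝ × ℝ)} {μ ν : P2}
    (h : IsCoupling π μ ν) (α : ℝ) :
    MemLp (fun p : ℝ × ℝ => α * p.1 + (1 - α) * p.2) 2 π := by
  have h1 : MemLp (fun p : ℝ × ℝ => p.1) 2 π := by
    have := μ.memLp
    rw [← h.fst_eq] at this
    exact (memLp_map_measure_iff (f := Prod.fst) (g := fun x : ℝ => x)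
      (by fun_prop) (by fun_prop)).1 this
  have h2 : MemLp (fun p : ℝ × ℝ => p.2) 2 π := by
    have := ν.memLp
    rw [← h.snd_eq] at this
    exact (memLp_map_measure_iff (f := Prod.snd) (g := fun x : ℝ => x)
      (by fun_prop) (by fun_prop)).1 this
  exact (h1.const_mul α).add (h2.const_mul (1 - α))

/-- The law of `α X + (1 - α) X'` when `(X, X') ∼ π`, for a coupling `π` of `μ` and `ν`. -/
def mix {π : Measure (ℝ × ℝ)} {μ ν : P2} (h : IsCoupling π μ ν) (α : ℝ) : P2 where
  toMeasure := π.map (fun p => α * p.1 + (1 - α) * p.2)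
  isProb := by
    have := h.isProbabilityMeasure
    exact Measure.isProbabilityMeasure_map (by fun_prop)
  memLp := (memLp_map_measure_iff (f := fun p : ℝ × ℝ => α * p.1 + (1 - α) * p.2)
    (g := fun x : ℝ => x) (by fun_prop) (by fun_prop)).2 (h.memLp_mix α)

/-- Lower semi-continuous (for the metric `W2`), proper, convex (along all couplings) functions
on the Wasserstein space with values in `ℝ ∪ {∞}`. -/
structure LscProperConvex (𝔣 : P2 → EReal) : Prop where
  lsc : ∀ μ : P2, ∀ c : EReal, c < 𝔣 μ → ∃ ε : ℝ, 0 < ε ∧ ∀ ν : P2, W2 μ ν < ε → c < 𝔣 ν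
  ne_bot : ∀ μ, 𝔣 μ ≠ ⊥
  proper : ∃ μ, 𝔣 μ ≠ ⊤
  convex : ∀ (μ ν : P2) (π : Measure (ℝ × ℝ)) (h : IsCoupling π μ ν) (α : ℝ), 0 ≤ α → α ≤ 1 →
    𝔣 (mix h α) ≤ (α : EReal) * 𝔣 μ + ((1 - α : ℝ) : EReal) * 𝔣 ν

/-- The objective `½ W₂(μ, ν)² + 𝔣(ν)` of the proximal problem on the Wasserstein space. -/
def proxObj (𝔣 : P2 → EReal) (μ ν : P2) : EReal :=
  ((1 / 2 * W2 μ ν ^ 2 : ℝ) : EReal) + 𝔣 ν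

/-- `ν` minimizes the proximal objective of `𝔣` at `μ`. -/
def IsProx (𝔣 : P2 → EReal) (μ ν : P2) : Prop :=
  ∀ ν' : P2, proxObj 𝔣 μ ν ≤ proxObj 𝔣 μ ν'

/-- The proximal operator on the Wasserstein space: a minimizer (if there is one). -/
def prox (𝔣 : P2 → EReal) (μ : P2) : P2 :=
  Classical.epsilon (IsProx 𝔣 μ)

/-- `𝔄` is an effective scalar representation of `𝔣`: for each `μ`, the law of `(Y, 𝔄(μ) ∘ Y)`
with `Y ∼ μ` is the optimal coupling of `μ` and `prox[𝔣](μ)`. -/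
def IsEffectiveScalarRep (𝔣 : P2 → EReal) (𝔄 : P2 → PR1) : Prop :=
  ∀ μ : P2, IsOptimalCoupling (μ.toMeasure.map (fun y => (y, (𝔄 μ).1 y))) μ (prox 𝔣 μ)

end P2

/-! The Hilbert space of square-integrable random variables on the unit interval -/

/-- Lebesgue measure on the unit interval. -/
abbrev unitVol : Measure ℝ := volume.restrict (Set.Ioo (0 : ℝ) 1)

instance : IsProbabilityMeasure unitVol := ⟨by simp [unitVol]⟩

/-- The space of square-integrable random variables on the unit interval. -/
abbrev L2unit : Type := Lp ℝ 2 unitVol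

/-- The law of a square-integrable random variable. -/
def law (Y : L2unit) : P2 where
  toMeasure := unitVol.map Y
  isProb := Measure.isProbabilityMeasure_map (Lp.aestronglyMeasurable Y).aemeasurable
  memLp := (memLp_map_measure_iff (by fun_prop) (Lp.aestronglyMeasurable Y).aemeasurable).2
    (Lp.memLp Y)

/-- `f` is symmetric: it depends on its argument only through the law. -/
def IsSymm (f : L2unit → EReal) : Prop := ∀ X X' : L2unit, law X = law X' → f X = f X'

/-- `𝔄` is an effective scalar representation of `f`: it is one of the function `𝔣` on the
Wasserstein space that is determined by `f(X) = 𝔣(μ_X)`. -/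
def IsEffectiveScalarRepL2 (f : L2unit → EReal) (𝔄 : P2 → PR1) : Prop :=
  ∃ 𝔣 : P2 → EReal, P2.LscProperConvex 𝔣 ∧ (∀ X, f X = 𝔣 (law X)) ∧ P2.IsEffectiveScalarRep 𝔣 𝔄

end

/-!
Everything is reduced to proximal operators on the Hilbert space `L2unit`.

On a Hilbert space, a minimizing sequence of the proximal objective is Cauchy by the parallelogram
law, and the objective grows quadratically around its minimizer (`IsProx.quadratic_growth`). Hence
the proximal operator is well defined and firmly nonexpansive:
`‖x₁ - x₂‖² ≤ ⟪x₁ - x₂, y₁ - y₂⟫`.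

Every `μ` is the law of some `Y` on the unit interval for which all couplings of `μ` are joint laws
of pairs `(Y, X)` (`exists_realizesCouplings`): `Y` uses only half of the available randomness, and
the other half randomizes conditional kernels. Minimizing over couplings of `μ` is thus minimizing
over `X` at such a `Y`. This identifies minimizers of the problem on the Wasserstein space with laws
of minimizers of the lifted problem `X ↦ 𝔣 (law X)`, and optimal couplings with joint laws of lifted
minimizers (`P2.isProx_law_of_isProx`, `P2.eq_law_of_isProx`,
`P2.isOptimalCoupling_iff_eq_jointLaw`). Neither compactness of the set of couplings nor the
monotone rearrangement is needed: quadratic growth makes near-optimal competitors converge.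

That the minimizer `X` at `Y` is a scalar function of `Y` comes from symmetry. Take two independent
copies of `(Y, X)` and exchange them on the event that they violate the pointwise inequality
`(x₁ - x₂)² ≤ (x₁ - x₂)(y₁ - y₂)`. The exchanged pair has the same joint law, so it is again a point
with its proximal point, and firm nonexpansiveness in `L2unit`, integrated over the event, shows
that the event is null (`ae_firmDefect_nonpos`). The inequality therefore holds on the support of
the joint law, which is then contained in the graph of a firmly nonexpansive `η : ℝ → ℝ`. Such maps
are exactly the scalar proximal operators (`FirmlyNonexpansive.mem_PR1`).
-/

/-! ### Proximal operators on a Hilbert space -/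

section Hilbert

variable {E : Type*} [NormedAddCommGroup E] [InnerProductSpace ℝ E] {f : E → EReal}

theorem LscProperConvex.le_real (hf : LscProperConvex f) {x y : E} {a b : ℝ} (hx : f x = a)
    (hy : f y = b) {α : ℝ} (h0 : 0 ≤ α) (h1 : α ≤ 1) :
    ∃ c : ℝ, f (α • x + (1 - α) • y) = c ∧ c ≤ α * a + (1 - α) * b := by
  have h := hf.convex x y α h0 h1
  rw [hx, hy, ← EReal.coe_mul, ← EReal.coe_mul, ← EReal.coe_add] at h
  have hne : f (α • x + (1 - α) • y) ≠ ⊤ := (h.trans_lt (EReal.coe_lt_top _)).ne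
  refine ⟨_, (EReal.coe_toReal hne (hf.ne_bot _)).symm, ?_⟩
  rw [← EReal.coe_toReal hne (hf.ne_bot _)] at h
  exact_mod_cast h

theorem LscProperConvex.exists_real (hf : LscProperConvex f) : ∃ (x : E) (a : ℝ), f x = a := by
  obtain ⟨x, hx⟩ := hf.proper
  exact ⟨x, _, (EReal.coe_toReal hx (hf.ne_bot _)).symm⟩

/-- Being bounded below near a point of its domain by lower semicontinuity, `f` decreases at most
linearly by convexity. -/
theorem LscProperConvex.exists_linear_lower_bound (hf : LscProperConvex f) :
    ∃ (x₀ : E) (A C : ℝ), 0 ≤ C ∧ ∀ (x : E) (b : ℝ), f x = b → A - C * ‖x - x₀‖ ≤ b := by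
  obtain ⟨x₀, a, ha⟩ := hf.exists_real
  have hlsc : ∀ᶠ x in nhds x₀, ((a - 1 : ℝ) : EReal) < f x :=
    hf.lsc x₀ _ (show _ < f x₀ by rw [ha]; exact_mod_cast sub_one_lt a)
  obtain ⟨r, hr, hball⟩ := Metric.eventually_nhds_iff.1 hlsc
  refine ⟨x₀, a - 1, 2 / r, by positivity, fun x b hb => ?_⟩
  rcases lt_or_ge (‖x - x₀‖) r with hx | hx
  · have h := hball (y := x) (by rwa [dist_eq_norm])
    rw [hb] at h
    have h' : a - 1 < b := by exact_mod_cast h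
    have : 0 ≤ 2 / r * ‖x - x₀‖ := by positivity
    linarith
  · set d := ‖x - x₀‖ with hd
    have hdpos : 0 < d := hr.trans_le hx
    -- the point of the segment from `x₀` to `x` at distance `r / 2` from `x₀`
    set t := r / (2 * d) with ht
    have ht0 : 0 < t := by positivity
    have ht1 : t ≤ 1 := by rw [ht, div_le_one (by positivity)]; linarith
    obtain ⟨c, hc, hle⟩ := hf.le_real hb ha ht0.le ht1
    have hz : t • x + (1 - t) • x₀ - x₀ = t • (x - x₀) := by module
    have h := hball (y := t • x + (1 - t) • x₀) (by
      rw [dist_eq_norm, hz, norm_smul, Real.norm_of_nonneg ht0.le, ← hd, ht]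
      field_simp; linarith)
    rw [hc] at h
    have h' : a - 1 < c := by exact_mod_cast h
    have h3 : t * (a - b) < 1 := by nlinarith
    have h4 : t * (2 / r * d) = 1 := by rw [ht]; field_simp
    have h5 : a - b < 2 / r * d := by
      by_contra! hcon
      have := mul_le_mul_of_nonneg_left hcon ht0.le
      linarith
    linarith

theorem proxObj_eq_coe {x : E} {a : ℝ} (y : E) (hx : f x = a) :
    proxObj f y x = ((1 / 2 * ‖y - x‖ ^ 2 + a : ℝ) : EReal) := by
  rw [proxObj, hx, ← EReal.coe_add]

theorem proxObj_eq_top {x : E} (y : E) (hx : f x = ⊤) : proxObj f y x = ⊤ := by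
  rw [proxObj, hx, EReal.coe_add_top]

/-- Since `f` is proper, a minimizer has a finite value, and only competitors with finite values
matter. -/
theorem LscProperConvex.isProx_iff (hf : LscProperConvex f) {y x : E} :
    IsProx f y x ↔ ∃ a : ℝ, f x = a ∧
      ∀ (z : E) (b : ℝ), f z = b → 1 / 2 * ‖y - x‖ ^ 2 + a ≤ 1 / 2 * ‖y - z‖ ^ 2 + b := by
  constructor
  · intro h
    obtain ⟨x₀, a₀, h₀⟩ := hf.exists_real
    have hne : f x ≠ ⊤ := by
      intro htop
      have := h x₀
      rw [proxObj_eq_top y htop, proxObj_eq_coe y h₀] at this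
      exact (EReal.coe_lt_top _).not_ge this
    have hx := (EReal.coe_toReal hne (hf.ne_bot x)).symm
    refine ⟨_, hx, fun z b hb => ?_⟩
    have := h z
    rw [proxObj_eq_coe y hx, proxObj_eq_coe y hb] at this
    exact_mod_cast this
  · rintro ⟨a, ha, h⟩ z
    by_cases hz : f z = ⊤
    · rw [proxObj_eq_top y hz]; exact le_top
    · have hb := (EReal.coe_toReal hz (hf.ne_bot z)).symm
      rw [proxObj_eq_coe y ha, proxObj_eq_coe y hb]
      exact_mod_cast h z _ hb

theorem norm_sub_convexCombo_sq (y z x : E) (t : ℝ) :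
    ‖y - (t • z + (1 - t) • x)‖ ^ 2
      = t * ‖y - z‖ ^ 2 + (1 - t) * ‖y - x‖ ^ 2 - t * (1 - t) * ‖z - x‖ ^ 2 := by
  have h1 : y - (t • z + (1 - t) • x) = t • (y - z) + (1 - t) • (y - x) := by module
  have h2 : z - x = (y - x) - (y - z) := by abel
  rw [h1, h2, norm_add_sq_real, norm_sub_sq_real (y - x) (y - z), norm_smul, norm_smul,
    inner_smul_left, inner_smul_right, real_inner_comm (y - z) (y - x), mul_pow, mul_pow,
    Real.norm_eq_abs, Real.norm_eq_abs, sq_abs, sq_abs]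
  simp only [conj_trivial]
  ring

/-- The proximal objective grows quadratically around its minimizer. -/
theorem IsProx.quadratic_growth (hf : LscProperConvex f) {y x z : E} (h : IsProx f y x) {a b : ℝ}
    (hx : f x = a) (hz : f z = b) :
    1 / 2 * ‖y - x‖ ^ 2 + a + 1 / 2 * ‖z - x‖ ^ 2 ≤ 1 / 2 * ‖y - z‖ ^ 2 + b := by
  obtain ⟨a', ha', hmin⟩ := hf.isProx_iff.1 h
  have haa : a' = a := by rw [hx] at ha'; exact_mod_cast ha'.symm
  subst haa
  -- compare `x` with the point `t z + (1 - t) x` of the segment, and let `t` tend to `0`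
  have key : ∀ t : ℝ, 0 < t → t ≤ 1 → 1 / 2 * ‖y - x‖ ^ 2 + a' + 1 / 2 * ‖z - x‖ ^ 2
      ≤ 1 / 2 * ‖y - z‖ ^ 2 + b + t * (1 / 2 * ‖z - x‖ ^ 2) := by
    intro t ht0 ht1
    obtain ⟨c, hc, hle⟩ := hf.le_real hz hx ht0.le ht1
    have h1 := hmin _ c hc
    rw [norm_sub_convexCombo_sq] at h1
    refine le_of_mul_le_mul_left ?_ ht0
    nlinarith
  refine le_of_forall_pos_le_add fun ε hε => ?_
  set C := 1 / 2 * ‖z - x‖ ^ 2 with hC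
  have hC0 : 0 ≤ C := by positivity
  have h2 := key (min 1 (ε / (C + 1))) (by positivity) (min_le_left _ _)
  have h3 : min 1 (ε / (C + 1)) * C ≤ ε := by
    calc min 1 (ε / (C + 1)) * C ≤ ε / (C + 1) * (C + 1) := by
          gcongr
          · exact min_le_right _ _
          · linarith
      _ = ε := by field_simp
  linarith

theorem IsProx.norm_sub_sq_le_inner (hf : LscProperConvex f) {y₁ y₂ x₁ x₂ : E}
    (h₁ : IsProx f y₁ x₁) (h₂ : IsProx f y₂ x₂) :
    ‖x₁ - x₂‖ ^ 2 ≤ inner ℝ (x₁ - x₂) (y₁ - y₂) := by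
  obtain ⟨a₁, ha₁, -⟩ := hf.isProx_iff.1 h₁
  obtain ⟨a₂, ha₂, -⟩ := hf.isProx_iff.1 h₂
  have e1 := h₁.quadratic_growth hf ha₁ ha₂
  have e2 := h₂.quadratic_growth hf ha₂ ha₁
  rw [norm_sub_rev x₂ x₁] at e1
  rw [inner_sub_left, inner_sub_right, inner_sub_right]
  rw [norm_sub_sq_real y₁ x₁, norm_sub_sq_real y₁ x₂] at e1
  rw [norm_sub_sq_real y₂ x₂, norm_sub_sq_real y₂ x₁] at e2
  rw [real_inner_comm y₁ x₁, real_inner_comm y₁ x₂, real_inner_comm y₂ x₁, real_inner_comm y₂ x₂]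
  linarith

theorem IsProx.norm_sub_le (hf : LscProperConvex f) {y₁ y₂ x₁ x₂ : E}
    (h₁ : IsProx f y₁ x₁) (h₂ : IsProx f y₂ x₂) : ‖x₁ - x₂‖ ≤ ‖y₁ - y₂‖ := by
  have h := (h₁.norm_sub_sq_le_inner hf h₂).trans (real_inner_le_norm _ _)
  rcases (norm_nonneg (x₁ - x₂)).eq_or_lt with h0 | h0
  · rw [← h0]; positivity
  · rw [sq] at h
    exact le_of_mul_le_mul_left h h0

theorem IsProx.unique (hf : LscProperConvex f) {y x₁ x₂ : E}
    (h₁ : IsProx f y x₁) (h₂ : IsProx f y x₂) : x₁ = x₂ := by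
  have := h₁.norm_sub_le hf h₂
  rw [sub_self, norm_zero] at this
  exact sub_eq_zero.1 (norm_le_zero_iff.1 this)

theorem LscProperConvex.exists_isProx [CompleteSpace E] (hf : LscProperConvex f) (y : E) :
    ∃ x, IsProx f y x := by
  set S : Set ℝ := {r | ∃ (x : E) (b : ℝ), f x = b ∧ r = 1 / 2 * ‖y - x‖ ^ 2 + b} with hS
  have hne : S.Nonempty := by
    obtain ⟨x, a, ha⟩ := hf.exists_real
    exact ⟨_, x, a, ha, rfl⟩
  have hbdd : BddBelow S := by
    obtain ⟨x₀, A, C, hC, hAC⟩ := hf.exists_linear_lower_bound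
    refine ⟨A - C * ‖y - x₀‖ - C ^ 2 / 2, ?_⟩
    rintro _ ⟨x, b, hb, rfl⟩
    have h1 := hAC x b hb
    have h2 : ‖x - x₀‖ ≤ ‖y - x‖ + ‖y - x₀‖ := by
      have : x - x₀ = (y - x₀) - (y - x) := by abel
      rw [this, add_comm]
      exact norm_sub_le _ _
    nlinarith [sq_nonneg (‖y - x‖ - C), mul_le_mul_of_nonneg_left h2 hC]
  set m := sInf S with hm
  have hex : ∀ n : ℕ, ∃ (x : E) (b : ℝ), f x = b ∧
      1 / 2 * ‖y - x‖ ^ 2 + b < m + 1 / ((n : ℝ) + 1) := by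
    intro n
    obtain ⟨r, ⟨x, b, hb, rfl⟩, hr⟩ := exists_lt_of_csInf_lt hne
      (lt_add_of_pos_right m (by positivity : 0 < 1 / ((n : ℝ) + 1)))
    exact ⟨x, b, hb, hr⟩
  choose u b hb hlt using hex
  -- midpoints are competitors too
  have hclose : ∀ n k : ℕ, ‖u n - u k‖ ^ 2 ≤ 4 * (1 / ((n : ℝ) + 1) + 1 / ((k : ℝ) + 1)) := by
    intro n k
    obtain ⟨c, hc, hle⟩ := hf.le_real (hb n) (hb k) (α := 1 / 2) (by norm_num) (by norm_num)
    have h1 : m ≤ _ := csInf_le hbdd ⟨_, c, hc, rfl⟩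
    rw [norm_sub_convexCombo_sq] at h1
    have h2 := hlt n
    have h3 := hlt k
    linarith
  have hlim0 : Filter.Tendsto (fun n : ℕ => 1 / ((n : ℝ) + 1)) Filter.atTop (nhds 0) :=
    tendsto_one_div_add_atTop_nhds_zero_nat
  have hcauchy : CauchySeq u := by
    refine Metric.cauchySeq_iff'.2 fun ε hε => ?_
    obtain ⟨N, hN⟩ := exists_nat_one_div_lt (by positivity : 0 < ε ^ 2 / 8)
    refine ⟨N, fun n hn => ?_⟩
    have h1 : 1 / ((n : ℝ) + 1) ≤ 1 / ((N : ℝ) + 1) := Nat.one_div_le_one_div hn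
    have h2 := hclose n N
    rw [dist_eq_norm]
    exact lt_of_pow_lt_pow_left₀ 2 hε.le (by linarith)
  obtain ⟨x, hx⟩ := cauchySeq_tendsto_of_complete hcauchy
  have hnorm : Filter.Tendsto (fun n => 1 / 2 * ‖y - u n‖ ^ 2) Filter.atTop
      (nhds (1 / 2 * ‖y - x‖ ^ 2)) := ((tendsto_const_nhds.sub hx).norm.pow 2).const_mul _
  have hfx : f x ≤ ((m - 1 / 2 * ‖y - x‖ ^ 2 : ℝ) : EReal) := by
    by_contra! hcon
    obtain ⟨c, hc1, hc2⟩ := EReal.lt_iff_exists_real_btwn.1 hcon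
    have hev := hx.eventually (hf.lsc x c hc2)
    have hle : c ≤ m + 0 - 1 / 2 * ‖y - x‖ ^ 2 := by
      refine ge_of_tendsto ((hlim0.const_add m).sub hnorm) ?_
      filter_upwards [hev] with n hn
      rw [hb n] at hn
      have h1 : c < b n := by exact_mod_cast hn
      linarith [hlt n]
    have : m - 1 / 2 * ‖y - x‖ ^ 2 < c := by exact_mod_cast hc1
    linarith
  refine ⟨x, hf.isProx_iff.2 ?_⟩
  have hfin : f x ≠ ⊤ := (hfx.trans_lt (EReal.coe_lt_top _)).ne
  have hx' := (EReal.coe_toReal hfin (hf.ne_bot x)).symm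
  refine ⟨_, hx', fun z c hz => ?_⟩
  rw [hx'] at hfx
  have h1 : (f x).toReal ≤ m - 1 / 2 * ‖y - x‖ ^ 2 := by exact_mod_cast hfx
  have h2 : m ≤ _ := csInf_le hbdd ⟨z, c, hz, rfl⟩
  linarith

theorem LscProperConvex.isProx_prox [CompleteSpace E] (hf : LscProperConvex f) (y : E) :
    IsProx f y (prox f y) :=
  Classical.epsilon_spec (hf.exists_isProx y)

theorem LscProperConvex.isProx_iff_eq_prox [CompleteSpace E] (hf : LscProperConvex f) (y x : E) :
    IsProx f y x ↔ x = prox f y :=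
  ⟨fun h => h.unique hf (hf.isProx_prox y), fun h => h ▸ hf.isProx_prox y⟩

theorem LscProperConvex.lipschitzWith_prox [CompleteSpace E] (hf : LscProperConvex f) :
    LipschitzWith 1 (prox f) := by
  refine LipschitzWith.of_dist_le_mul fun y₁ y₂ => ?_
  rw [NNReal.coe_one, one_mul, dist_eq_norm, dist_eq_norm]
  exact (hf.isProx_prox y₁).norm_sub_le hf (hf.isProx_prox y₂)

end Hilbert

/-! ### Scalar proximal operators -/

/-- Scalar firm nonexpansiveness, which characterizes the non-decreasing `1`-Lipschitz maps. -/
def FirmlyNonexpansive (η : ℝ → ℝ) : Prop :=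
  ∀ x y : ℝ, (η x - η y) ^ 2 ≤ (η x - η y) * (x - y)

theorem FirmlyNonexpansive.lipschitzWith {η : ℝ → ℝ} (h : FirmlyNonexpansive η) :
    LipschitzWith 1 η := by
  refine LipschitzWith.of_dist_le_mul fun x y => ?_
  rw [NNReal.coe_one, one_mul, Real.dist_eq, Real.dist_eq]
  have := h x y
  refine sq_le_sq.1 ?_
  nlinarith [sq_nonneg ((x - y) - (η x - η y))]

theorem FirmlyNonexpansive.monotone {η : ℝ → ℝ} (h : FirmlyNonexpansive η) : Monotone η := by
  intro x y hxy
  by_contra! hlt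
  have := h x y
  nlinarith [mul_pos (sub_pos.2 hlt) (sub_pos.2 hlt)]

theorem firmlyNonexpansive_of_mem_PR1 {η : ℝ → ℝ} (h : η ∈ PR1) : FirmlyNonexpansive η := by
  obtain ⟨ρ, hρ, hη⟩ := h
  intro x y
  have := ((hη x _).2 rfl).norm_sub_sq_le_inner hρ ((hη y _).2 rfl)
  simpa [mul_comm] using this

/-- A firmly nonexpansive `η` is the proximal operator of `ρ(x) = sup_d (ψ(x + d) - d² / 2)`, where
`ψ` is the convex primitive of `y ↦ y - η y`. -/
theorem FirmlyNonexpansive.mem_PR1 {η : ℝ → ℝ} (h : FirmlyNonexpansive η) : η ∈ PR1 := by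
  have hc : Continuous η := h.lipschitzWith.continuous
  set Φ : ℝ → ℝ := fun y => ∫ s in (0 : ℝ)..y, η s with hΦ
  have hderiv : ∀ y, HasDerivAt Φ (η y) y := fun y =>
    intervalIntegral.integral_hasDerivAt_right (hc.intervalIntegrable _ _)
      (hc.stronglyMeasurableAtFilter _ _) hc.continuousAt
  have hΦconv : ConvexOn ℝ Set.univ Φ := by
    refine Monotone.convexOn_univ_of_deriv (fun y => (hderiv y).differentiableAt) ?_
    rw [funext fun y => (hderiv y).deriv]
    exact h.monotone
  -- `Φ` lies above its tangents
  have hsub : ∀ y z, Φ y + η y * (z - y) ≤ Φ z := by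
    intro y z
    rcases lt_trichotomy y z with hyz | hyz | hyz
    · have := hΦconv.le_slope_of_hasDerivAt (Set.mem_univ y) (Set.mem_univ z) hyz (hderiv y)
      rw [slope_def_field, le_div_iff₀ (sub_pos.2 hyz)] at this
      linarith
    · simp [hyz]
    · have := hΦconv.slope_le_of_hasDerivAt (Set.mem_univ z) (Set.mem_univ y) hyz (hderiv y)
      rw [slope_def_field, div_le_iff₀ (sub_pos.2 hyz)] at this
      linarith
  set ψ : ℝ → ℝ := fun y => 1 / 2 * y ^ 2 - Φ y with hψ
  have hψd : ∀ y, HasDerivAt ψ (y - η y) y := by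
    intro y
    have h1 : HasDerivAt (fun y : ℝ => 1 / 2 * y ^ 2) y y := by
      refine ((hasDerivAt_pow 2 y).const_mul (1 / 2 : ℝ)).congr_deriv ?_
      norm_num
      ring
    exact h1.sub (hderiv y)
  have hψconv : ConvexOn ℝ Set.univ ψ := by
    refine Monotone.convexOn_univ_of_deriv (fun y => (hψd y).differentiableAt) ?_
    rw [funext fun y => (hψd y).deriv]
    intro x y hxy
    have := h.lipschitzWith.dist_le_mul y x
    rw [NNReal.coe_one, one_mul, Real.dist_eq, Real.dist_eq, abs_of_nonneg (sub_nonneg.2 hxy)]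
      at this
    have := (abs_le.1 this).2
    show x - η x ≤ y - η y
    linarith
  have hψcont : Continuous ψ := continuous_iff_continuousAt.2 fun y => (hψd y).continuousAt
  set ρ : ℝ → EReal := fun x => ⨆ d : ℝ, ((ψ (x + d) - 1 / 2 * d ^ 2 : ℝ) : EReal) with hρ
  -- the supremum defining `ρ (η y)` is attained at `d = y - η y`
  have hval : ∀ y, ρ (η y) = ((ψ y - 1 / 2 * (y - η y) ^ 2 : ℝ) : EReal) := by
    intro y
    apply le_antisymm
    · refine iSup_le fun d => ?_
      have := hsub y (η y + d)
      norm_cast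
      simp only [hψ]
      nlinarith
    · refine le_iSup_of_le (y - η y) ?_
      rw [add_sub_cancel]
  have hlow : ∀ x y, ((ψ y - 1 / 2 * (y - x) ^ 2 : ℝ) : EReal) ≤ ρ x := fun x y =>
    le_iSup_of_le (y - x) (by rw [add_sub_cancel])
  have hρconv : LscProperConvex ρ := by
    refine ⟨?_, fun x hx => ?_, ⟨η 0, by rw [hval]; exact EReal.coe_ne_top _⟩, ?_⟩
    · refine lowerSemicontinuous_iSup fun d => Continuous.lowerSemicontinuous ?_
      exact continuous_coe_real_ereal.comp (by fun_prop)
    · have := hlow x 0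
      rw [hx, le_bot_iff] at this
      exact EReal.coe_ne_bot _ this
    · intro x y α h0 h1
      refine iSup_le fun d => ?_
      have hcv := hψconv.2 (Set.mem_univ (x + d)) (Set.mem_univ (y + d)) h0 (sub_nonneg.2 h1)
        (by ring)
      simp only [smul_eq_mul] at hcv ⊢
      have he : α * x + (1 - α) * y + d = α * (x + d) + (1 - α) * (y + d) := by ring
      calc ((ψ (α * x + (1 - α) * y + d) - 1 / 2 * d ^ 2 : ℝ) : EReal)
          ≤ ((α * (ψ (x + d) - 1 / 2 * d ^ 2) + (1 - α) * (ψ (y + d) - 1 / 2 * d ^ 2) : ℝ)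
              : EReal) := by
            norm_cast
            rw [he]
            linarith
        _ = (α : EReal) * ((ψ (x + d) - 1 / 2 * d ^ 2 : ℝ) : EReal)
              + ((1 - α : ℝ) : EReal) * ((ψ (y + d) - 1 / 2 * d ^ 2 : ℝ) : EReal) := by
            rw [← EReal.coe_mul, ← EReal.coe_mul, ← EReal.coe_add]
        _ ≤ _ := by
            have hα : (0 : EReal) ≤ (α : EReal) := by exact_mod_cast h0
            have hα' : (0 : EReal) ≤ ((1 - α : ℝ) : EReal) := by exact_mod_cast sub_nonneg.2 h1
            exact add_le_add
              (mul_le_mul_of_nonneg_left (le_iSup_of_le d le_rfl) hα)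
              (mul_le_mul_of_nonneg_left (le_iSup_of_le d le_rfl) hα')
  have hprox : ∀ y, IsProx ρ y (η y) := by
    intro y
    refine hρconv.isProx_iff.2 ⟨_, hval y, fun z b hb => ?_⟩
    have := hlow z y
    rw [hb] at this
    have h2 : ψ y - 1 / 2 * (y - z) ^ 2 ≤ b := by exact_mod_cast this
    rw [Real.norm_eq_abs, Real.norm_eq_abs, sq_abs, sq_abs]
    linarith
  exact ⟨ρ, hρconv, fun y x => ⟨fun hx => hx.unique hρconv (hprox y), fun hx => hx ▸ hprox y⟩⟩

/-- A firmly nonexpansive relation on the line is contained in the graph of a firmly nonexpansive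
map. -/
theorem exists_firmlyNonexpansive_extension {S : Set (ℝ × ℝ)}
    (hS : ∀ p ∈ S, ∀ q ∈ S, (p.2 - q.2) ^ 2 ≤ (p.2 - q.2) * (p.1 - q.1)) :
    ∃ η : ℝ → ℝ, FirmlyNonexpansive η ∧ ∀ p ∈ S, p.2 = η p.1 := by
  classical
  have hfun : ∀ p ∈ S, ∀ q ∈ S, p.1 = q.1 → p.2 = q.2 := by
    intro p hp q hq hpq
    have := hS p hp q hq
    rw [hpq, sub_self, mul_zero] at this
    exact sub_eq_zero.1 ((pow_eq_zero_iff two_ne_zero).1 (le_antisymm this (sq_nonneg _)))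
  have hval : ∀ y : ℝ, ∃ x : ℝ, ∀ p ∈ S, p.1 = y → p.2 = x := by
    intro y
    by_cases hy : ∃ p ∈ S, p.1 = y
    · obtain ⟨p, hp, rfl⟩ := hy
      exact ⟨p.2, fun q hq h => hfun q hq p hp h⟩
    · exact ⟨0, fun p hp h => (hy ⟨p, hp, h⟩).elim⟩
  choose g hg using hval
  -- `η` is firmly nonexpansive iff `2 η - id` is nonexpansive, and nonexpansive maps extend
  have hlip : LipschitzOnWith 1 (fun y => 2 * g y - y) (Prod.fst '' S) := by
    refine LipschitzOnWith.of_dist_le_mul ?_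
    rintro _ ⟨p, hp, rfl⟩ _ ⟨q, hq, rfl⟩
    rw [NNReal.coe_one, one_mul, Real.dist_eq, Real.dist_eq, ← hg _ p hp rfl, ← hg _ q hq rfl]
    refine sq_le_sq.1 ?_
    nlinarith [hS p hp q hq]
  obtain ⟨u, hu, hug⟩ := hlip.extend_real
  refine ⟨fun y => (u y + y) / 2, fun x y => ?_, fun p hp => ?_⟩
  · have h1 := hu.dist_le_mul x y
    rw [NNReal.coe_one, one_mul, Real.dist_eq, Real.dist_eq] at h1
    have h2 := sq_le_sq.2 h1
    nlinarith
  · have := hug (Set.mem_image_of_mem Prod.fst hp)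
    simp only at this ⊢
    rw [← this, ← hg _ p hp rfl]
    ring

/-! ### Couplings realized on the unit interval -/

/-- The joint law of two square-integrable random variables on the unit interval. -/
noncomputable def jointLaw (Y X : L2unit) : Measure (ℝ × ℝ) := unitVol.map (fun ω => (Y ω, X ω))

theorem L2unit.aemeasurable (X : L2unit) : AEMeasurable X unitVol :=
  (Lp.aestronglyMeasurable X).aemeasurable

theorem aemeasurable_pair (Y X : L2unit) : AEMeasurable (fun ω => (Y ω, X ω)) unitVol :=
  Y.aemeasurable.prodMk X.aemeasurable

instance (Y X : L2unit) : IsProbabilityMeasure (jointLaw Y X) :=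
  Measure.isProbabilityMeasure_map (aemeasurable_pair Y X)

theorem map_fst_jointLaw (Y X : L2unit) : (jointLaw Y X).map Prod.fst = (law Y).toMeasure := by
  rw [jointLaw, AEMeasurable.map_map_of_aemeasurable (by fun_prop) (aemeasurable_pair Y X)]
  rfl

theorem map_snd_jointLaw (Y X : L2unit) : (jointLaw Y X).map Prod.snd = (law X).toMeasure := by
  rw [jointLaw, AEMeasurable.map_map_of_aemeasurable (by fun_prop) (aemeasurable_pair Y X)]
  rfl

theorem isCoupling_jointLaw (Y X : L2unit) : P2.IsCoupling (jointLaw Y X) (law Y) (law X) :=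
  ⟨map_fst_jointLaw Y X, map_snd_jointLaw Y X⟩

theorem L2unit.norm_sq_eq_integral (X : L2unit) : ‖X‖ ^ 2 = ∫ ω, X ω ^ 2 ∂unitVol := by
  rw [← real_inner_self_eq_norm_sq, L2.inner_def]
  simp [sq]

theorem cost_jointLaw (Y X : L2unit) : P2.cost (jointLaw Y X) = ‖Y - X‖ ^ 2 := by
  rw [P2.cost, jointLaw, integral_map (aemeasurable_pair Y X) (by fun_prop),
    L2unit.norm_sq_eq_integral]
  refine integral_congr_ae ?_
  filter_upwards [Lp.coeFn_sub Y X] with ω h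
  rw [h, Pi.sub_apply]

theorem mix_jointLaw (Y X : L2unit) (h : P2.IsCoupling (jointLaw Y X) (law Y) (law X)) (α : ℝ) :
    P2.mix h α = law (α • Y + (1 - α) • X) := by
  ext1
  change (jointLaw Y X).map (fun p => α * p.1 + (1 - α) * p.2)
    = unitVol.map ⇑(α • Y + (1 - α) • X)
  rw [jointLaw, AEMeasurable.map_map_of_aemeasurable (by fun_prop) (aemeasurable_pair Y X)]
  refine Measure.map_congr ?_
  filter_upwards [Lp.coeFn_add (α • Y) ((1 - α) • X), Lp.coeFn_smul α Y,
    Lp.coeFn_smul (1 - α) X] with ω h1 h2 h3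
  rw [h1, Pi.add_apply, h2, h3]
  rfl

theorem jointLaw_eq_of_ae_eq {Y X : L2unit} {η : ℝ → ℝ} (hη : Measurable η)
    (h : ⇑X =ᵐ[unitVol] fun ω => η (Y ω)) :
    jointLaw Y X = (law Y).toMeasure.map (fun y => (y, η y)) := by
  rw [law, AEMeasurable.map_map_of_aemeasurable (by fun_prop) Y.aemeasurable, jointLaw]
  refine Measure.map_congr ?_
  filter_upwards [h] with ω hω
  rw [hω]; rfl

/-- A random variable on the unit interval whose law is square-integrable defines an element of
`L2unit`. -/
theorem exists_L2unit_ae_eq {X : ℝ → ℝ} {ν : P2} (hX : AEMeasurable X unitVol)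
    (h : unitVol.map X = ν.toMeasure) :
    ∃ X' : L2unit, ⇑X' =ᵐ[unitVol] X ∧ law X' = ν := by
  have hmem : MemLp X 2 unitVol := by
    have := ν.memLp
    rw [← h] at this
    exact (memLp_map_measure_iff (g := fun x : ℝ => x) (by fun_prop) hX).1 this
  refine ⟨hmem.toLp X, hmem.coeFn_toLp, ?_⟩
  ext1
  rw [law, ← h]
  exact Measure.map_congr hmem.coeFn_toLp

/-- The unit interval carries random elements of any law on a standard Borel space. -/
theorem exists_measurable_map_unitVol_eq {S : Type*} [Nonempty S] [MeasurableSpace S]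
    [StandardBorelSpace S] (P : Measure S) [IsProbabilityMeasure P] :
    ∃ Z : ℝ → S, Measurable Z ∧ unitVol.map Z = P := by
  obtain ⟨F, hF, hFP⟩ := P.exists_measurable_map_eq
  set p : ℝ → unitInterval := Set.projIcc 0 1 zero_le_one with hp
  have hpm : Measurable p := continuous_projIcc.measurable
  refine ⟨F ∘ p, hF.comp hpm, ?_⟩
  rw [← Measure.map_map hF hpm, ← hFP]
  congr 1
  have hI : unitVol = volume.restrict unitInterval := Measure.restrict_congr_set Ioo_ae_eq_Icc
  rw [hI, ← unitInterval.measurePreserving_coe.map_eq,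
    Measure.map_map hpm measurable_subtype_coe]
  have : p ∘ ((↑) : unitInterval → ℝ) = id := by
    funext x
    exact Set.projIcc_val zero_le_one x
  rw [this, Measure.map_id]

/-- `Y` leaves enough randomness on the unit interval to realize every coupling of its law. -/
def RealizesCouplings (Y : L2unit) : Prop :=
  ∀ (ν : P2) (π : Measure (ℝ × ℝ)), P2.IsCoupling π (law Y) ν →
    ∃ X : L2unit, law X = ν ∧ jointLaw Y X = π

/-- Splitting the unit interval into a variable of law `μ` and an independent uniform variable, a
coupling is realized by the randomization of its conditional kernel. -/
theorem exists_realizesCouplings (μ : P2) : ∃ Y : L2unit, law Y = μ ∧ RealizesCouplings Y := by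
  obtain ⟨Z, hZ, hZP⟩ :=
    exists_measurable_map_unitVol_eq (μ.toMeasure.prod (volume : Measure unitInterval))
  have hfst : unitVol.map (fun ω => (Z ω).1) = μ.toMeasure := by
    have : unitVol.map (Prod.fst ∘ Z) = μ.toMeasure := by
      rw [← Measure.map_map measurable_fst hZ, hZP, Measure.map_fst_prod, measure_univ, one_smul]
    exact this
  obtain ⟨Y, hYZ, hY⟩ := exists_L2unit_ae_eq (by fun_prop) hfst
  refine ⟨Y, hY, fun ν π hπ => ?_⟩
  rw [hY] at hπ
  have hprob := hπ.isProbabilityMeasure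
  obtain ⟨g, hg, hgk⟩ := Kernel.exists_measurable_map_eq_unitInterval π.condKernel
  have hmeas : Measurable fun p : ℝ × unitInterval => (p.1, g p.1 p.2) :=
    measurable_fst.prodMk hg
  have hmap : (μ.toMeasure.prod (volume : Measure unitInterval)).map
      (fun p => (p.1, g p.1 p.2)) = π := by
    have hdis := π.disintegrate π.condKernel
    rw [Measure.fst, hπ.fst_eq] at hdis
    rw [← hdis]
    refine Measure.ext_of_lintegral _ fun h hh => ?_
    have hh' : Measurable fun p : ℝ × unitInterval => h (p.1, g p.1 p.2) := hh.comp hmeas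
    rw [lintegral_map hh hmeas, Measure.lintegral_compProd hh,
      lintegral_prod _ hh'.aemeasurable]
    refine lintegral_congr fun a => ?_
    have hga : Measurable (g a) := hg.comp measurable_prodMk_left
    have hha : Measurable fun b => h (a, b) := hh.comp measurable_prodMk_left
    rw [← hgk a, lintegral_map hha hga]
  have hpair : unitVol.map (fun ω => ((Z ω).1, g (Z ω).1 (Z ω).2)) = π := by
    rw [← hmap, ← hZP, Measure.map_map hmeas hZ]
    rfl
  have hpairmeas : Measurable fun ω => ((Z ω).1, g (Z ω).1 (Z ω).2) := hmeas.comp hZ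
  have hXmeas : Measurable fun ω => g (Z ω).1 (Z ω).2 := hg.comp hZ
  have hX : unitVol.map (fun ω => g (Z ω).1 (Z ω).2) = ν.toMeasure := by
    rw [← hπ.snd_eq, ← hpair, Measure.map_map measurable_snd hpairmeas]
    rfl
  obtain ⟨X, hXZ, hXν⟩ := exists_L2unit_ae_eq hXmeas.aemeasurable hX
  refine ⟨X, hXν, ?_⟩
  rw [← hpair]
  refine Measure.map_congr ?_
  filter_upwards [hYZ, hXZ] with ω h1 h2
  rw [h1, h2]

/-! ### The Wasserstein distance -/

namespace P2

theorem cost_nonneg (π : Measure (ℝ × ℝ)) : 0 ≤ cost π :=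
  integral_nonneg fun _ => sq_nonneg _

theorem isCoupling_prod (μ ν : P2) : IsCoupling (μ.toMeasure.prod ν.toMeasure) μ ν :=
  ⟨by simp, by simp⟩

theorem W2_nonneg (μ ν : P2) : 0 ≤ W2 μ ν := Real.sqrt_nonneg _

theorem W2_sq (μ ν : P2) :
    W2 μ ν ^ 2 = ⨅ π : {π : Measure (ℝ × ℝ) // IsCoupling π μ ν}, cost π.1 :=
  Real.sq_sqrt (Real.iInf_nonneg fun π => cost_nonneg π.1)

theorem IsCoupling.W2_sq_le {π : Measure (ℝ × ℝ)} {μ ν : P2} (h : IsCoupling π μ ν) :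
    W2 μ ν ^ 2 ≤ cost π := by
  rw [W2_sq]
  exact ciInf_le ⟨0, by rintro _ ⟨π, rfl⟩; exact cost_nonneg π.1⟩
    (⟨π, h⟩ : {π : Measure (ℝ × ℝ) // IsCoupling π μ ν})

theorem exists_isCoupling_cost_lt {μ ν : P2} {r : ℝ} (h : W2 μ ν ^ 2 < r) :
    ∃ π, IsCoupling π μ ν ∧ cost π < r := by
  rw [W2_sq] at h
  have : Nonempty {π : Measure (ℝ × ℝ) // IsCoupling π μ ν} := ⟨⟨_, isCoupling_prod μ ν⟩⟩
  obtain ⟨π, hπ⟩ := exists_lt_of_ciInf_lt h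
  exact ⟨π.1, π.2, hπ⟩

end P2

theorem W2_law_le (Y X : L2unit) : P2.W2 (law Y) (law X) ≤ ‖Y - X‖ := by
  refine le_of_sq_le_sq ?_ (norm_nonneg _)
  rw [← cost_jointLaw]
  exact (isCoupling_jointLaw Y X).W2_sq_le

theorem law_eq_of_tendsto {X : ℕ → L2unit} {X₀ : L2unit} {ν : P2}
    (h : Filter.Tendsto X Filter.atTop (nhds X₀)) (hX : ∀ n, law (X n) = ν) : law X₀ = ν := by
  have h1 : TendstoInDistribution (fun n => ⇑(X n)) Filter.atTop X₀ (fun _ => unitVol) unitVol :=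
    (tendstoInMeasure_of_tendsto_Lp h).tendstoInDistribution_of_aemeasurable
      (fun n => (X n).aemeasurable) X₀.aemeasurable
  have h2 : TendstoInDistribution (fun n => ⇑(X n)) Filter.atTop (fun x : ℝ => x)
      (fun _ => unitVol) ν.toMeasure := by
    refine tendstoInDistribution_of_identDistrib 0 (fun n => ?_) ?_
    · exact ⟨(X 0).aemeasurable, (X n).aemeasurable,
        congrArg P2.toMeasure ((hX 0).trans (hX n).symm)⟩
    · refine ⟨(X 0).aemeasurable, by fun_prop, ?_⟩
      rw [Measure.map_id']
      exact congrArg P2.toMeasure (hX 0)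
  have h3 := tendstoInDistribution_unique _ h1 h2
  rw [Measure.map_id'] at h3
  ext1
  exact h3

/-! ### Exchanging independent copies -/

/-- Exchanging two independent copies on a symmetric event does not change the law. -/
theorem map_ite_swap_prod {S : Type*} [MeasurableSpace S] (P : Measure S) [IsProbabilityMeasure P]
    {B : Set (S × S)} [DecidablePred (· ∈ B)] (hB : MeasurableSet B)
    (hsymm : Prod.swap ⁻¹' B = B) :
    (P.prod P).map (fun p => if p ∈ B then p.2 else p.1) = P := by
  have hm : Measurable fun p : S × S => if p ∈ B then p.2 else p.1 :=
    Measurable.ite hB measurable_snd measurable_fst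
  ext s hs
  rw [Measure.map_apply hm hs]
  have hE : MeasurableSet (Prod.fst ⁻¹' s : Set (S × S)) := measurable_fst hs
  have hE' : MeasurableSet (Prod.snd ⁻¹' s : Set (S × S)) := measurable_snd hs
  rw [← measure_inter_add_sdiff _ hB]
  have e1 : (fun p : S × S => if p ∈ B then p.2 else p.1) ⁻¹' s ∩ B = Prod.snd ⁻¹' s ∩ B := by
    ext p
    simp only [Set.mem_inter_iff, Set.mem_preimage]
    constructor <;> rintro ⟨h1, h2⟩ <;> simpa [h2] using h1
  have e2 : (fun p : S × S => if p ∈ B then p.2 else p.1) ⁻¹' s \ B = Prod.fst ⁻¹' s \ B := by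
    ext p
    simp only [Set.mem_sdiff, Set.mem_preimage]
    constructor <;> rintro ⟨h1, h2⟩ <;> simpa [h2] using h1
  have e3 : P.prod P (Prod.snd ⁻¹' s ∩ B) = P.prod P (Prod.fst ⁻¹' s ∩ B) := by
    rw [← (Measure.measurePreserving_swap (μ := P) (ν := P)).measure_preimage
      (hE.inter hB).nullMeasurableSet, Set.preimage_inter, hsymm]
    rfl
  rw [e1, e2, e3, measure_inter_add_sdiff _ hB, ← Set.prod_univ, Measure.prod_prod, measure_univ,
    mul_one]

/-! ### Symmetric functions of random variables -/

theorem proxObj_congr_jointLaw {f : L2unit → EReal} (hs : IsSymm f) {Y X Y' X' : L2unit}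
    (h : jointLaw Y X = jointLaw Y' X') : proxObj f Y X = proxObj f Y' X' := by
  have hlaw : law X = law X' := by
    ext1
    rw [← map_snd_jointLaw Y X, h, map_snd_jointLaw]
  rw [proxObj, proxObj, ← cost_jointLaw, ← cost_jointLaw, h, hs X X' hlaw]

/-- Being a proximal point depends on the joint law only: any competitor at `Y'` has the same joint
law as a competitor at `Y`. -/
theorem IsProx.of_jointLaw_eq {f : L2unit → EReal} (hs : IsSymm f) {Y X Y' X' : L2unit}
    (hY : RealizesCouplings Y) (hX : IsProx f Y X) (h : jointLaw Y' X' = jointLaw Y X) :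
    IsProx f Y' X' := by
  intro W
  have hlaw : law Y' = law Y := by
    ext1
    rw [← map_fst_jointLaw Y' X', h, map_fst_jointLaw]
  obtain ⟨V, -, hV⟩ := hY (law W) (jointLaw Y' W) (hlaw ▸ isCoupling_jointLaw Y' W)
  rw [proxObj_congr_jointLaw hs h, proxObj_congr_jointLaw hs hV.symm]
  exact hX V

/-- The defect of firm nonexpansiveness of a pair of points of the plane. -/
noncomputable def firmDefect (p : (ℝ × ℝ) × (ℝ × ℝ)) : ℝ :=
  (p.1.2 - p.2.2) ^ 2 - (p.1.2 - p.2.2) * (p.1.1 - p.2.1)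

theorem continuous_firmDefect : Continuous firmDefect := by
  unfold firmDefect
  fun_prop

theorem firmDefect_swap (p : (ℝ × ℝ) × (ℝ × ℝ)) : firmDefect p.swap = firmDefect p := by
  simp only [firmDefect, Prod.fst_swap, Prod.snd_swap]
  ring

/-- Two independent copies of `(Y, prox f Y)` satisfy the inequality of firm nonexpansiveness
pointwise: exchange them where it fails. The resulting pair still has the law of
`(Y, prox f Y)`, hence consists of a point and its proximal point, and firm nonexpansiveness in
`L2unit` forces the event of failure to be null. -/
theorem ae_firmDefect_nonpos {f : L2unit → EReal} (hf : LscProperConvex f) (hs : IsSymm f)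
    {Y X : L2unit} (hY : RealizesCouplings Y) (hX : IsProx f Y X) :
    ∀ᵐ p ∂((jointLaw Y X).prod (jointLaw Y X)), firmDefect p ≤ 0 := by
  classical
  set P := jointLaw Y X with hP
  obtain ⟨Z, hZ, hZP⟩ := exists_measurable_map_unitVol_eq (P.prod P)
  set B : Set ((ℝ × ℝ) × (ℝ × ℝ)) := {p | 0 < firmDefect p} with hBdef
  have hB : MeasurableSet B := (isOpen_lt continuous_const continuous_firmDefect).measurableSet
  have hBs : Prod.swap ⁻¹' B = B := by
    ext p
    simp only [hBdef, Set.mem_preimage, Set.mem_ofPred_eq, firmDefect_swap]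
  set T : (ℝ × ℝ) × (ℝ × ℝ) → ℝ × ℝ := fun p => if p ∈ B then p.2 else p.1 with hT
  have hTm : Measurable T := Measurable.ite hB measurable_snd measurable_fst
  have hTP : (P.prod P).map T = P := map_ite_swap_prod P hB hBs
  -- variables with the joint law of `(Y, X)` consist of a point and its proximal point
  have hpair : ∀ G : ℝ → ℝ × ℝ, Measurable G → unitVol.map G = P →
      ∃ Y' X' : L2unit, ⇑Y' =ᵐ[unitVol] (fun ω => (G ω).1) ∧
        ⇑X' =ᵐ[unitVol] (fun ω => (G ω).2) ∧ IsProx f Y' X' := by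
    intro G hG hGP
    have h1 : unitVol.map (fun ω => (G ω).1) = (law Y).toMeasure := by
      rw [← map_fst_jointLaw Y X, ← hP, ← hGP, Measure.map_map measurable_fst hG]
      rfl
    have h2 : unitVol.map (fun ω => (G ω).2) = (law X).toMeasure := by
      rw [← map_snd_jointLaw Y X, ← hP, ← hGP, Measure.map_map measurable_snd hG]
      rfl
    obtain ⟨Y', hY', -⟩ := exists_L2unit_ae_eq (by fun_prop) h1
    obtain ⟨X', hX', -⟩ := exists_L2unit_ae_eq (by fun_prop) h2
    refine ⟨Y', X', hY', hX', hX.of_jointLaw_eq hs hY ?_⟩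
    rw [← hP, ← hGP]
    refine Measure.map_congr ?_
    filter_upwards [hY', hX'] with ω e1 e2
    rw [e1, e2]
  obtain ⟨Y₁, X₁, hY₁, hX₁, hp₁⟩ := hpair (fun ω => (Z ω).1) (by fun_prop) (by
    have : unitVol.map (Prod.fst ∘ Z) = P := by
      rw [← Measure.map_map measurable_fst hZ, hZP, Measure.map_fst_prod, measure_univ, one_smul]
    exact this)
  obtain ⟨Y₂, X₂, hY₂, hX₂, hp₂⟩ := hpair (fun ω => T (Z ω)) (hTm.comp hZ) (by
    have : unitVol.map (T ∘ Z) = P := by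
      rw [← Measure.map_map hTm hZ, hZP, hTP]
    exact this)
  have hfirm := hp₁.norm_sub_sq_le_inner hf hp₂
  rw [← real_inner_self_eq_norm_sq, ← sub_nonpos, ← inner_sub_right, L2.inner_def] at hfirm
  -- off `B` both pairs coincide, on `B` their difference is that of the two copies
  have hae : ∀ᵐ ω ∂unitVol, inner ℝ ((X₁ - X₂ : L2unit) ω) ((X₁ - X₂ - (Y₁ - Y₂) : L2unit) ω)
      = max (firmDefect (Z ω)) 0 := by
    filter_upwards [hY₁, hX₁, hY₂, hX₂, Lp.coeFn_sub X₁ X₂, Lp.coeFn_sub Y₁ Y₂,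
      Lp.coeFn_sub (X₁ - X₂) (Y₁ - Y₂)] with ω a1 a2 a3 a4 a5 a6 a7
    rw [a7, Pi.sub_apply, a6, a5, Pi.sub_apply, Pi.sub_apply, a1, a2, a3, a4]
    by_cases hω : Z ω ∈ B
    · have hω' : 0 < firmDefect (Z ω) := hω
      rw [max_eq_left hω'.le]
      simp only [hT, if_pos hω, firmDefect, RCLike.inner_apply, conj_trivial]
      ring
    · have hω' : firmDefect (Z ω) ≤ 0 := not_lt.1 hω
      rw [max_eq_right hω']
      simp [hT, if_neg hω]
  have hint : Integrable (fun ω => max (firmDefect (Z ω)) 0) unitVol :=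
    (L2.integrable_inner (𝕜 := ℝ) (X₁ - X₂) (X₁ - X₂ - (Y₁ - Y₂))).congr hae
  rw [integral_congr_ae hae] at hfirm
  have hzero := (integral_eq_zero_iff_of_nonneg (fun ω => le_max_right _ _) hint).1
    (le_antisymm hfirm (integral_nonneg fun ω => le_max_right _ _))
  rw [← hZP, ae_map_iff hZ.aemeasurable
    (measurableSet_le continuous_firmDefect.measurable measurable_const)]
  filter_upwards [hzero] with ω hω
  exact max_eq_right_iff.1 hω

/-- For a symmetric `f`, one scalar map serves all `Y` of law `μ`. -/
theorem exists_scalar_prox {f : L2unit → EReal} (hf : LscProperConvex f) (hs : IsSymm f) (μ : P2) :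
    ∃ η : ℝ → ℝ, FirmlyNonexpansive η ∧
      ∀ Y : L2unit, law Y = μ → ⇑(prox f Y) =ᵐ[unitVol] fun ω => η (Y ω) := by
  obtain ⟨Y₀, rfl, hY₀⟩ := exists_realizesCouplings μ
  set X₀ := prox f Y₀ with hX₀
  have hprox : IsProx f Y₀ X₀ := hf.isProx_prox Y₀
  have hae := ae_firmDefect_nonpos hf hs hY₀ hprox
  set P := jointLaw Y₀ X₀ with hP
  -- the inequality is closed, and neighbourhoods of support points have positive mass
  have hsupp : ∀ p ∈ P.support, ∀ q ∈ P.support,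
      (p.2 - q.2) ^ 2 ≤ (p.2 - q.2) * (p.1 - q.1) := by
    intro p hp q hq
    by_contra! hlt
    have hopen : IsOpen {r : (ℝ × ℝ) × (ℝ × ℝ) | 0 < firmDefect r} :=
      isOpen_lt continuous_const continuous_firmDefect
    have hmem : {r : (ℝ × ℝ) × (ℝ × ℝ) | 0 < firmDefect r} ∈ nhds (p, q) :=
      hopen.mem_nhds (sub_pos.2 hlt)
    obtain ⟨U, hU, V, hV, hUV⟩ := mem_nhds_prod_iff.1 hmem
    have hpos : 0 < P.prod P (U ×ˢ V) := by
      rw [Measure.prod_prod]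
      exact ENNReal.mul_pos ((Measure.mem_support_iff_forall p).1 hp U hU).ne'
        ((Measure.mem_support_iff_forall q).1 hq V hV).ne'
    refine (hpos.trans_le (measure_mono hUV)).ne' ?_
    simpa [ae_iff] using hae
  obtain ⟨η, hη, hηS⟩ := exists_firmlyNonexpansive_extension hsupp
  have hηm : Measurable η := hη.lipschitzWith.continuous.measurable
  refine ⟨η, hη, fun Y hY => ?_⟩
  have hX₀η : ⇑X₀ =ᵐ[unitVol] fun ω => η (Y₀ ω) := by
    have h1 : ∀ᵐ p ∂P, p.2 = η p.1 := by
      filter_upwards [P.support_mem_ae] with p hp using hηS p hp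
    exact ae_of_ae_map (aemeasurable_pair Y₀ X₀) h1
  have hlawη : unitVol.map (fun ω => η (Y ω)) = (law X₀).toMeasure := by
    have e : ∀ W : L2unit, unitVol.map (fun ω => η (W ω)) = (law W).toMeasure.map η := fun W => by
      rw [law, AEMeasurable.map_map_of_aemeasurable hηm.aemeasurable W.aemeasurable]
      rfl
    rw [e, hY, ← e]
    exact (Measure.map_congr hX₀η).symm
  obtain ⟨X, hX, -⟩ := exists_L2unit_ae_eq (hηm.comp_aemeasurable Y.aemeasurable) hlawη
  have hXp : IsProx f Y X := hprox.of_jointLaw_eq hs hY₀ (by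
    rw [jointLaw_eq_of_ae_eq hηm hX, hY, jointLaw_eq_of_ae_eq hηm hX₀η])
  rw [← hXp.unique hf (hf.isProx_prox Y)]
  exact hX

/-- A symmetric function induces a function on the Wasserstein space. Lower semicontinuity passes
to it because all measures near `law Y` are laws of variables near a fixed `Y`. -/
theorem exists_lscProperConvex_P2 {f : L2unit → EReal} (hf : LscProperConvex f) (hs : IsSymm f) :
    ∃ 𝔣 : P2 → EReal, P2.LscProperConvex 𝔣 ∧ ∀ X, f X = 𝔣 (law X) := by
  choose Q hQ hQr using exists_realizesCouplings
  have hfac : ∀ X, f X = f (Q (law X)) := fun X => hs _ _ (hQ (law X)).symm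
  refine ⟨fun μ => f (Q μ), ⟨fun μ c hc => ?_, fun μ => hf.ne_bot _, ?_, ?_⟩, hfac⟩
  · have hev : ∀ᶠ X in nhds (Q μ), c < f X := hf.lsc (Q μ) c hc
    obtain ⟨ε, hε, hball⟩ := Metric.eventually_nhds_iff.1 hev
    refine ⟨ε, hε, fun ν hν => ?_⟩
    obtain ⟨π, hπ, hcost⟩ := P2.exists_isCoupling_cost_lt
      (pow_lt_pow_left₀ hν (P2.W2_nonneg μ ν) two_ne_zero)
    rw [← hQ μ] at hπ
    obtain ⟨X, rfl, rfl⟩ := hQr μ ν π hπ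
    rw [cost_jointLaw] at hcost
    rw [← hfac]
    refine hball ?_
    rw [dist_comm, dist_eq_norm]
    exact lt_of_pow_lt_pow_left₀ 2 hε.le hcost
  · obtain ⟨X, hX⟩ := hf.proper
    exact ⟨law X, by rwa [← hfac]⟩
  · intro μ ν π hπ α h0 h1
    have hπ' := hπ
    rw [← hQ μ] at hπ'
    obtain ⟨X, rfl, rfl⟩ := hQr μ ν π hπ'
    have := hf.convex (Q μ) X α h0 h1
    rw [hfac (α • Q μ + (1 - α) • X), ← mix_jointLaw (Q μ) X hπ', hfac X] at this
    convert this using 3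
    ext1
    rfl

/-! ### Lifting functions on the Wasserstein space -/

namespace P2

theorem LscProperConvex.comp_law {𝔣 : P2 → EReal} (h : LscProperConvex 𝔣) :
    _root_.LscProperConvex fun X : L2unit => 𝔣 (law X) := by
  refine ⟨fun X c hc => ?_, fun X => h.ne_bot _, ?_, fun X X' α h0 h1 => ?_⟩
  · obtain ⟨ε, hε, hν⟩ := h.lsc (law X) c hc
    refine Metric.eventually_nhds_iff.2 ⟨ε, hε, fun X' hX' => hν _ ?_⟩
    rw [dist_comm, dist_eq_norm] at hX'
    exact (W2_law_le X X').trans_lt hX'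
  · obtain ⟨μ, hμ⟩ := h.proper
    obtain ⟨X, rfl, -⟩ := exists_realizesCouplings μ
    exact ⟨X, hμ⟩
  · rw [← mix_jointLaw X X' (isCoupling_jointLaw X X')]
    exact h.convex _ _ _ _ α h0 h1

theorem isSymm_comp_law (𝔣 : P2 → EReal) : IsSymm fun X : L2unit => 𝔣 (law X) :=
  fun _ _ h => congrArg 𝔣 h

theorem proxObj_law_le (𝔣 : P2 → EReal) (Y X : L2unit) :
    proxObj 𝔣 (law Y) (law X) ≤ _root_.proxObj (fun X => 𝔣 (law X)) Y X := by
  rw [proxObj, _root_.proxObj]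
  refine add_le_add ?_ le_rfl
  have := pow_le_pow_left₀ (W2_nonneg _ _) (W2_law_le Y X) 2
  norm_cast
  linarith

/-- The infimum over couplings of the lifted objective is the objective on the Wasserstein
space, so a lifted minimizer projects to a minimizer. -/
theorem isProx_law_of_isProx {𝔣 : P2 → EReal} (h𝔣 : LscProperConvex 𝔣) {Y X : L2unit}
    (hY : RealizesCouplings Y) (hX : _root_.IsProx (fun X => 𝔣 (law X)) Y X) :
    IsProx 𝔣 (law Y) (law X) := by
  intro ν
  obtain ⟨a, ha, hmin⟩ := h𝔣.comp_law.isProx_iff.1 hX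
  refine (proxObj_law_le 𝔣 Y X).trans ?_
  by_cases hν : 𝔣 ν = ⊤
  · rw [proxObj, hν, EReal.coe_add_top]; exact le_top
  have hb := (EReal.coe_toReal hν (h𝔣.ne_bot ν)).symm
  rw [proxObj_eq_coe Y ha, proxObj, hb, ← EReal.coe_add]
  norm_cast
  refine le_of_forall_pos_le_add fun ε hε => ?_
  obtain ⟨π, hπ, hcost⟩ := exists_isCoupling_cost_lt (lt_add_of_pos_right (W2 (law Y) ν ^ 2) hε)
  obtain ⟨V, rfl, rfl⟩ := hY ν π hπ
  rw [cost_jointLaw] at hcost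
  have := hmin V _ hb
  linarith

/-- Realizing near-optimal couplings of `law Y` and `ν` gives a minimizing sequence at `Y` of
variables of law `ν`; it converges to the lifted minimizer by quadratic growth. -/
theorem eq_law_of_isProx {𝔣 : P2 → EReal} (h𝔣 : LscProperConvex 𝔣) {Y X : L2unit}
    (hY : RealizesCouplings Y) (hX : _root_.IsProx (fun X => 𝔣 (law X)) Y X) {ν : P2}
    (hν : IsProx 𝔣 (law Y) ν) : ν = law X := by
  obtain ⟨a, ha, -⟩ := h𝔣.comp_law.isProx_iff.1 hX
  have hle := (hν (law X)).trans (proxObj_law_le 𝔣 Y X)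
  rw [proxObj_eq_coe Y ha, proxObj] at hle
  have hfin : 𝔣 ν ≠ ⊤ := by
    intro htop
    rw [htop, EReal.coe_add_top] at hle
    exact (EReal.coe_lt_top _).not_ge hle
  have hb := (EReal.coe_toReal hfin (h𝔣.ne_bot ν)).symm
  rw [hb, ← EReal.coe_add] at hle
  have hle' : 1 / 2 * W2 (law Y) ν ^ 2 + (𝔣 ν).toReal ≤ 1 / 2 * ‖Y - X‖ ^ 2 + a := by
    exact_mod_cast hle
  have hex : ∀ n : ℕ, ∃ V : L2unit, law V = ν ∧ ‖V - X‖ ^ 2 ≤ 1 / ((n : ℝ) + 1) := by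
    intro n
    obtain ⟨π, hπ, hcost⟩ := exists_isCoupling_cost_lt (lt_add_of_pos_right (W2 (law Y) ν ^ 2)
      (by positivity : 0 < 1 / ((n : ℝ) + 1)))
    obtain ⟨V, hV, rfl⟩ := hY ν π hπ
    refine ⟨V, hV, ?_⟩
    rw [cost_jointLaw] at hcost
    have := hX.quadratic_growth h𝔣.comp_law (z := V) ha (by rw [hV, hb])
    linarith
  choose V hV hVX using hex
  have hlim : Filter.Tendsto V Filter.atTop (nhds X) := by
    rw [tendsto_iff_norm_sub_tendsto_zero]
    have hsq : Filter.Tendsto (fun n => ‖V n - X‖ ^ 2) Filter.atTop (nhds 0) :=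
      squeeze_zero (fun n => sq_nonneg _) hVX tendsto_one_div_add_atTop_nhds_zero_nat
    have := hsq.sqrt
    simpa using this
  exact (law_eq_of_tendsto hlim hV).symm

/-- Optimal couplings of `law Y` and the proximal measure are realized by minimizers at `Y`. -/
theorem isOptimalCoupling_iff_eq_jointLaw {𝔣 : P2 → EReal} (h𝔣 : LscProperConvex 𝔣) {Y X : L2unit}
    (hY : RealizesCouplings Y) (hX : _root_.IsProx (fun X => 𝔣 (law X)) Y X)
    (π : Measure (ℝ × ℝ)) : IsOptimalCoupling π (law Y) (law X) ↔ π = jointLaw Y X := by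
  obtain ⟨a, ha, hmin⟩ := h𝔣.comp_law.isProx_iff.1 hX
  constructor
  · rintro ⟨hπ, hopt⟩
    obtain ⟨V, hV, rfl⟩ := hY _ π hπ
    have hVa : 𝔣 (law V) = a := by rw [hV, ha]
    have hc := hopt _ (isCoupling_jointLaw Y X)
    rw [cost_jointLaw, cost_jointLaw] at hc
    have hVp : _root_.IsProx (fun X => 𝔣 (law X)) Y V := by
      refine h𝔣.comp_law.isProx_iff.2 ⟨a, hVa, fun z b hb => ?_⟩
      have := hmin z b hb
      linarith
    rw [hVp.unique h𝔣.comp_law hX]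
  · rintro rfl
    refine ⟨isCoupling_jointLaw Y X, fun π' hπ' => ?_⟩
    obtain ⟨V, hV, rfl⟩ := hY _ π' hπ'
    rw [cost_jointLaw, cost_jointLaw]
    have := hmin V a (by rw [hV, ha])
    linarith

theorem LscProperConvex.isProx_iff_eq_prox {𝔣 : P2 → EReal} (h𝔣 : LscProperConvex 𝔣) (μ ν : P2) :
    IsProx 𝔣 μ ν ↔ ν = prox 𝔣 μ := by
  obtain ⟨Y, rfl, hY⟩ := exists_realizesCouplings μ
  have hX := h𝔣.comp_law.isProx_prox Y
  have hex := isProx_law_of_isProx h𝔣 hY hX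
  have hspec : IsProx 𝔣 (law Y) (prox 𝔣 (law Y)) := Classical.epsilon_spec ⟨_, hex⟩
  refine ⟨fun h => ?_, fun h => h ▸ hspec⟩
  rw [eq_law_of_isProx h𝔣 hY hX h, eq_law_of_isProx h𝔣 hY hX hspec]

/-- The scalar map of the lifted function yields the unique optimal coupling. -/
theorem LscProperConvex.exists_scalar_prox {𝔣 : P2 → EReal} (h𝔣 : LscProperConvex 𝔣) (μ : P2) :
    ∃ η : ℝ → ℝ, FirmlyNonexpansive η ∧
      (∀ π, IsOptimalCoupling π μ (prox 𝔣 μ) ↔ π = μ.toMeasure.map fun y => (y, η y)) ∧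
      ∀ Y : L2unit, law Y = μ →
        ⇑(_root_.prox (fun X => 𝔣 (law X)) Y) =ᵐ[unitVol] fun ω => η (Y ω) := by
  obtain ⟨η, hη, hηY⟩ := _root_.exists_scalar_prox h𝔣.comp_law (isSymm_comp_law 𝔣) μ
  refine ⟨η, hη, fun π => ?_, hηY⟩
  obtain ⟨Y, rfl, hY⟩ := exists_realizesCouplings μ
  have hX := h𝔣.comp_law.isProx_prox Y
  rw [← (h𝔣.isProx_iff_eq_prox _ _).1 (isProx_law_of_isProx h𝔣 hY hX),
    isOptimalCoupling_iff_eq_jointLaw h𝔣 hY hX,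
    jointLaw_eq_of_ae_eq hη.lipschitzWith.continuous.measurable (hηY Y rfl)]

end P2

/-! ### Effective scalar representations -/

namespace P2

theorem LscProperConvex.isEffectiveScalarRep_iff {𝔣 : P2 → EReal} (h𝔣 : LscProperConvex 𝔣)
    (𝔄 : P2 → PR1) : IsEffectiveScalarRep 𝔣 𝔄 ↔ ∀ Y : L2unit,
      ⇑(_root_.prox (fun X => 𝔣 (law X)) Y) =ᵐ[unitVol] fun ω => (𝔄 (law Y)).1 (Y ω) := by
  have hm : ∀ μ, Measurable (𝔄 μ).1 := fun μ =>
    (firmlyNonexpansive_of_mem_PR1 (𝔄 μ).2).lipschitzWith.continuous.measurable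
  constructor
  · intro h Y
    obtain ⟨η, hη, hopt, hηY⟩ := h𝔣.exists_scalar_prox (law Y)
    have heq := (hopt _).1 (h (law Y))
    have hηm : Measurable η := hη.lipschitzWith.continuous.measurable
    -- two maps whose graphs carry the same law coincide almost everywhere
    have hae : ∀ᵐ y ∂(law Y).toMeasure, (𝔄 (law Y)).1 y = η y := by
      have hs : MeasurableSet {p : ℝ × ℝ | p.2 = η p.1} :=
        measurableSet_eq_fun measurable_snd (hηm.comp measurable_fst)
      have h1 : ∀ᵐ p ∂(law Y).toMeasure.map (fun y => (y, η y)), p.2 = η p.1 := by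
        rw [ae_map_iff (by fun_prop) hs]
        exact Filter.Eventually.of_forall fun _ => rfl
      rw [← heq] at h1
      exact ae_of_ae_map (measurable_id.prodMk (hm _)).aemeasurable h1
    filter_upwards [hηY Y rfl, ae_of_ae_map Y.aemeasurable hae] with ω h1 h2
    rw [h1, h2]
  · intro h μ
    obtain ⟨η, hη, hopt, hηY⟩ := h𝔣.exists_scalar_prox μ
    obtain ⟨Y, rfl, -⟩ := exists_realizesCouplings μ
    rw [hopt, ← jointLaw_eq_of_ae_eq hη.lipschitzWith.continuous.measurable (hηY Y rfl),
      jointLaw_eq_of_ae_eq (hm _) (h Y)]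

theorem LscProperConvex.exists_isEffectiveScalarRep {𝔣 : P2 → EReal} (h𝔣 : LscProperConvex 𝔣) :
    ∃ 𝔄 : P2 → PR1, IsEffectiveScalarRep 𝔣 𝔄 := by
  choose η hη hopt _ using h𝔣.exists_scalar_prox
  exact ⟨fun μ => ⟨η μ, (hη μ).mem_PR1⟩, fun μ => (hopt μ _).2 rfl⟩

end P2

theorem isEffectiveScalarRepL2_iff {f : L2unit → EReal} (hf : LscProperConvex f) (hs : IsSymm f)
    (𝔄 : P2 → PR1) : IsEffectiveScalarRepL2 f 𝔄 ↔
      ∀ Y : L2unit, ⇑(prox f Y) =ᵐ[unitVol] fun ω => (𝔄 (law Y)).1 (Y ω) := by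
  constructor
  · rintro ⟨𝔣, h𝔣, hfac, hrep⟩
    rw [funext hfac]
    exact (h𝔣.isEffectiveScalarRep_iff 𝔄).1 hrep
  · intro h
    obtain ⟨𝔣, h𝔣, hfac⟩ := exists_lscProperConvex_P2 hf hs
    rw [funext hfac] at h
    exact ⟨𝔣, h𝔣, hfac, (h𝔣.isEffectiveScalarRep_iff 𝔄).2 h⟩

theorem mainTheorem7 :
    -- proximal operators on the Wasserstein space and effective scalar estimators
    (∀ 𝔣 : P2 → EReal, P2.LscProperConvex 𝔣 →
      (∀ μ ν : P2, P2.IsProx 𝔣 μ ν ↔ ν = P2.prox 𝔣 μ) ∧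
      (∀ μ : P2, ∃ η : ℝ → ℝ, η ∈ PR1 ∧ Monotone η ∧ LipschitzWith 1 η ∧
        ∀ (Ω : Type*) [MeasurableSpace Ω] (P : Measure Ω) (Y : Ω → ℝ),
          HasLaw Y μ.toMeasure P →
          ∀ π : Measure (ℝ × ℝ), P2.IsOptimalCoupling π μ (P2.prox 𝔣 μ) ↔
            π = P.map (fun ω => (Y ω, η (Y ω)))) ∧
      (∃ 𝔄 : P2 → PR1, P2.IsEffectiveScalarRep 𝔣 𝔄)) ∧
    -- proximal operators on the Hilbert space of random variables
    (∀ f : L2unit → EReal, LscProperConvex f →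
      (∀ Y X : L2unit, IsProx f Y X ↔ X = prox f Y) ∧
      LipschitzWith 1 (prox f)) ∧
    -- the symmetric case
    (∀ f : L2unit → EReal, LscProperConvex f → IsSymm f →
      (∃ 𝔄 : P2 → PR1, IsEffectiveScalarRepL2 f 𝔄) ∧
      (∀ 𝔄 : P2 → PR1, IsEffectiveScalarRepL2 f 𝔄 ↔
        ∀ Y : L2unit, ⇑(prox f Y) =ᵐ[unitVol] fun ω => (𝔄 (law Y)).1 (Y ω)) ∧
      (∀ Y Y' : L2unit, law Y = law Y' →
        unitVol.map (fun ω => (Y ω, prox f Y ω)) = unitVol.map (fun ω => (Y' ω, prox f Y' ω))) ∧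
      (∀ Y : L2unit, ∃ Z : ℝ → ℝ,
        Measurable[MeasurableSpace.comap (fun ω => Y ω) inferInstance] Z ∧
        ⇑(prox f Y) =ᵐ[unitVol] Z)) := by
  refine ⟨fun 𝔣 h𝔣 => ⟨h𝔣.isProx_iff_eq_prox, fun μ => ?_, h𝔣.exists_isEffectiveScalarRep⟩,
    fun f hf => ⟨hf.isProx_iff_eq_prox, hf.lipschitzWith_prox⟩,
    fun f hf hs => ⟨?_, isEffectiveScalarRepL2_iff hf hs, fun Y Y' hYY' => ?_, fun Y => ?_⟩⟩
  · obtain ⟨η, hη, hopt, -⟩ := h𝔣.exists_scalar_prox μ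
    refine ⟨η, hη.mem_PR1, hη.monotone, hη.lipschitzWith, fun Ω _ P Y hY π => ?_⟩
    have hm : Measurable η := hη.lipschitzWith.continuous.measurable
    rw [hopt, ← hY.map_eq, AEMeasurable.map_map_of_aemeasurable (by fun_prop) hY.aemeasurable]
    rfl
  · obtain ⟨𝔣, h𝔣, hfac⟩ := exists_lscProperConvex_P2 hf hs
    obtain ⟨𝔄, h𝔄⟩ := h𝔣.exists_isEffectiveScalarRep
    exact ⟨𝔄, 𝔣, h𝔣, hfac, h𝔄⟩
  · obtain ⟨η, hη, hηY⟩ := exists_scalar_prox hf hs (law Y)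
    have hm : Measurable η := hη.lipschitzWith.continuous.measurable
    have h1 := jointLaw_eq_of_ae_eq hm (hηY Y rfl)
    have h2 := jointLaw_eq_of_ae_eq hm (hηY Y' hYY'.symm)
    rw [← hYY', ← h1] at h2
    exact h2.symm
  · obtain ⟨η, hη, hηY⟩ := exists_scalar_prox hf hs (law Y)
    exact ⟨fun ω => η (Y ω),
      hη.lipschitzWith.continuous.measurable.comp (comap_measurable _), hηY Y rfl⟩
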